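/- There is an absolute constant $c>0$ such that the following holds for all integers $m\ge 1$, $1\le r<d$ and every $\delta>0$. Let $X\in\mathbb{R}^{d\times d}$ and $\hat X^1,\dots,\hat X^m\in\mathbb{R}^{d\times d}$ be symmetric, and write $\lambda_1(X)\ge\dots\ge\lambda_d(X)$ for the eigenvalues of $X$. Assume $$\lambda_r(X)-\lambda_{r+1}(X)\ge\delta\qquad\text{and}\qquad \|\hat X^i-X\|_2<\frac{\delta}{8}\quad\text{for all } i=1,\dots,m,$$ where $\|\cdot\|_2$ is the spectral norm. Let $V_1\in\mathbb{R}^{d\times r}$ and $\hat V_1^{(i)}\in\mathbb{R}^{d\times r}$ be matrices whose columns are orthonormal bases of the leading $r$-dimensional invariant subspaces (those of the $r$ largest eigenvalues) of $X$ and $\hat X^i$, respectively. Fix a reference index $k\in\{1,\dots,m\}$ (by default $k=1$), and let $\mathbb{O}_r$ be the set of orthogonal $r\times r$ matrices. Procrustes fixing (Algorithm 1) computes $$\tilde V^{(i)}:=\hat V_1^{(i)}Z_i,\quad Z_i\in\operatorname*{argmin}_{Z\in\mathbb{O}_r}\|\hat V_1^{(i)}Z-\hat V_1^{(k)}\|_F,\qquad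 \bar V:=\frac1m\sum_{i=1}^m\tilde V^{(i)},$$ and returns the factor $\tilde V$ with orthonormal columns of a QR factorization $\bar V=\tilde V\tilde R$. Put $$B:=\frac{1}{\delta^2}\max_{1\le i\le m}\|\hat X^i-X\|_2^2+\frac1\delta\Big\|\frac1m\sum_{i=1}^m\hat X^i-X\Big\|_2 .$$ 1. If the basis $V_1$ is chosen aligned with the reference solution, i.e. $I_r\in\operatorname*{argmin}_{U\in\mathbb{O}_r}\|\hat V_1^{(k)}U-V_1\|_F$, then $$\Big\|\frac1m\sum_{i=1}^m\tilde V^{(i)}-V_1\Big\|_2\le c\,B .$$ 2. Consequently, for every choice of the orthonormal basis $V_1$, $$\operatorname{dist}_2(\tilde V,V_1):=\|\tilde V\tilde V^{\mathsf T}-V_1V_1^{\mathsf T}\|_2\le c\,B .$$ -/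

import Mathlib

-- In everything that follows, `‖A‖` for a real matrix `A` is the spectral norm (`ℓ²` operator norm).
open scoped Matrix.Norms.L2Operator

/-- The eigenvalues of a real symmetric `d × d` matrix, with multiplicity and in decreasing order:
`sortedEigenvalues hX j` is the `(j+1)`-st largest eigenvalue. -/
noncomputable def sortedEigenvalues {d : ℕ} {X : Matrix (Fin d) (Fin d) ℝ} (hX : X.IsHermitian)
    (j : Fin d) : ℝ :=
  hX.eigenvalues₀ (Fin.cast (Fintype.card_fin d).symm j)

/-- `V` is a `d × r` matrix with orthonormal columns spanning a leading `r`-dimensional invariant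
subspace of the symmetric matrix `X`: up to a rotation of the columns by an orthogonal matrix `U`,
they are eigenvectors belonging to the `r` largest eigenvalues of `X`. -/
def IsLeadingBasis {d r : ℕ} {X : Matrix (Fin d) (Fin d) ℝ} (hX : X.IsHermitian) (hrd : r ≤ d)
    (V : Matrix (Fin d) (Fin r) ℝ) : Prop :=
  V.transpose * V = 1 ∧
    ∃ U ∈ Matrix.orthogonalGroup (Fin r) ℝ,
      X * (V * U) =
        (V * U) * Matrix.diagonal (fun j : Fin r => sortedEigenvalues hX (Fin.castLE hrd j))

/-- The Frobenius norm. -/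
noncomputable def frobeniusNorm {p q : ℕ} (A : Matrix (Fin p) (Fin q) ℝ) : ℝ :=
  Real.sqrt (∑ i, ∑ j, A i j ^ 2)

/-- `Z` is a minimizer of `‖V Z - W‖_F` over orthogonal `r × r` matrices `Z`. -/
def IsProcrustesSolution {d r : ℕ} (V W : Matrix (Fin d) (Fin r) ℝ)
    (Z : Matrix (Fin r) (Fin r) ℝ) : Prop :=
  Z ∈ Matrix.orthogonalGroup (Fin r) ℝ ∧
    ∀ U ∈ Matrix.orthogonalGroup (Fin r) ℝ,
      frobeniusNorm (V * Z - W) ≤ frobeniusNorm (V * U - W)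

/-- `A = Q R` is a (thin) QR factorization of the `d × r` matrix `A`: `Q` has orthonormal columns
and `R` is upper triangular. -/
def IsQR {d r : ℕ} (A Q : Matrix (Fin d) (Fin r) ℝ) (R : Matrix (Fin r) (Fin r) ℝ) : Prop :=
  Q.transpose * Q = 1 ∧ (∀ i j : Fin r, j < i → R i j = 0) ∧ A = Q * R

/-- The average `(1/m) ∑ᵢ Aᵢ`. -/
noncomputable def matrixAverage {m p q : ℕ} (A : Fin m → Matrix (Fin p) (Fin q) ℝ) :
    Matrix (Fin p) (Fin q) ℝ :=
  (m : ℝ)⁻¹ • ∑ i, A i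

/-- A run of distributed eigenspace estimation with Procrustes fixing, with local bases `Vloc i`
and reference solution `Vref`: every local basis is aligned with the reference by a solution of the
orthogonal Procrustes problem, giving `Valigned i`, and the output `Vout` is the `Q` factor of a
QR factorization of the average of the aligned bases. -/
structure IsProcrustesFixingRun {m d r : ℕ} (Vloc : Fin m → Matrix (Fin d) (Fin r) ℝ)
    (Vref : Matrix (Fin d) (Fin r) ℝ) (Valigned : Fin m → Matrix (Fin d) (Fin r) ℝ)
    (Vout : Matrix (Fin d) (Fin r) ℝ) : Prop where
  aligned : ∀ i, ∃ Z, IsProcrustesSolution (Vloc i) Vref Z ∧ Valigned i = Vloc i * Z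
  output : ∃ R, IsQR (matrixAverage Valigned) Vout R

/-- The subspace distance `‖U Uᵀ - V Vᵀ‖₂`. -/
noncomputable def dist₂ {d r : ℕ} (U V : Matrix (Fin d) (Fin r) ℝ) : ℝ :=
  ‖U * U.transpose - V * V.transpose‖

/-!
Write `E i = Xhat i - X` and `ε` for the largest `‖E i‖ / δ`. The average of the aligned bases is
compared with `V`, the basis of the leading eigenspace of `X` aligned with the reference `R`.

For every local basis `P`, the Sylvester bound `sylvester_bound`, whose constant is the inverse of
the gap in every dimension, combined with Weyl's inequality gives `‖(1 - V Vᵀ) P‖ = O(ε)`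
(`norm_complProj_mul_le`). Optimality in the Procrustes problem forces `Vᵀ R` and `Rᵀ P` to be
symmetric and positive semidefinite (`IsProcrustesSolution.posSemidef`). Both matrices are
orthogonal up to `O(ε²)`, and a positive semidefinite matrix `H` satisfies `‖H - 1‖ ≤ ‖H² - 1‖`, so
`C = Vᵀ P` is within `O(ε²)` of the identity (`norm_transpose_mul_sub_one_le`). Aligning with the
reference rather than with `V` itself therefore costs only a second-order error.

It remains to control the component orthogonal to `V`. The matrix `Y = (1 - V Vᵀ) P C⁻¹` solves a
Riccati equation (`riccati_identity`) whose linear part is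
`Y A - X Y = (1 - V Vᵀ) E V`, with a remainder quadratic in the perturbation and free of `‖X‖`.
Since the linear part is the same for every sample, averaging gives a Sylvester equation for the
mean of the `Y` whose right-hand side is the mean perturbation plus `O(ε² δ)`, and the Sylvester
bound concludes (`norm_matrixAverage_sub_le`).

Any other basis of the leading eigenspace has an aligned rotation
(`exists_orthogonal_mul_posSemidef`), which has the same projection, and passing from the average
to the projection onto its column space loses a constant factor (`dist₂_le_of_norm_sub_le`).
-/

/-! ### Quadratic forms and the spectral norm -/

theorem dotProduct_self_eq_norm_sq {n : Type*} [Fintype n] (x : n → ℝ) :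
    x ⬝ᵥ x = ‖WithLp.toLp 2 x‖ ^ 2 := by
  rw [EuclideanSpace.real_norm_sq_eq]
  simp [dotProduct, sq]

theorem dotProduct_mulVec_self_le {m n : Type*} [Fintype m] [Fintype n] [DecidableEq n]
    (A : Matrix m n ℝ) (x : n → ℝ) :
    (A.mulVec x) ⬝ᵥ (A.mulVec x) ≤ ‖A‖ ^ 2 * (x ⬝ᵥ x) := by
  rw [dotProduct_self_eq_norm_sq, dotProduct_self_eq_norm_sq, ← mul_pow]
  exact pow_le_pow_left₀ (norm_nonneg _) (Matrix.l2_opNorm_mulVec A (WithLp.toLp 2 x)) 2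

theorem l2_opNorm_le_of_forall_dotProduct {m n : Type*} [Fintype m] [Fintype n] [DecidableEq n]
    (A : Matrix m n ℝ) {c : ℝ} (hc : 0 ≤ c)
    (h : ∀ x, (A.mulVec x) ⬝ᵥ (A.mulVec x) ≤ c ^ 2 * (x ⬝ᵥ x)) : ‖A‖ ≤ c := by
  rw [Matrix.l2_opNorm_def]
  refine ContinuousLinearMap.opNorm_le_bound _ hc fun x => ?_
  have := h x.ofLp
  rw [dotProduct_self_eq_norm_sq, dotProduct_self_eq_norm_sq, ← mul_pow] at this
  exact le_of_sq_le_sq this (by positivity)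

theorem dotProduct_sq_le {n : Type*} [Fintype n] (x y : n → ℝ) :
    (x ⬝ᵥ y) ^ 2 ≤ (x ⬝ᵥ x) * (y ⬝ᵥ y) := by
  have := Finset.sum_mul_sq_le_sq_mul_sq Finset.univ x y
  simpa [dotProduct, sq] using this

theorem dotProduct_self_nonneg_real {n : Type*} [Fintype n] (x : n → ℝ) : 0 ≤ x ⬝ᵥ x :=
  Finset.sum_nonneg fun i _ => mul_self_nonneg (x i)

theorem abs_dotProduct_mulVec_le {n : Type*} [Fintype n] [DecidableEq n]
    (A : Matrix n n ℝ) (x : n → ℝ) : |x ⬝ᵥ A.mulVec x| ≤ ‖A‖ * (x ⬝ᵥ x) := by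
  have h1 := dotProduct_sq_le x (A.mulVec x)
  have h2 := dotProduct_mulVec_self_le A x
  have h3 := dotProduct_self_nonneg_real x
  refine abs_le_of_sq_le_sq ?_ (by positivity)
  nlinarith [mul_le_mul_of_nonneg_left h2 h3]

theorem dotProduct_mulVec_eq {m n : Type*} [Fintype m] [Fintype n]
    (A : Matrix m n ℝ) (x : m → ℝ) (y : n → ℝ) :
    x ⬝ᵥ A.mulVec y = (A.transpose.mulVec x) ⬝ᵥ y := by
  rw [Matrix.dotProduct_mulVec, Matrix.mulVec_transpose]

theorem l2_opNorm_transpose {p q : Type*} [Fintype p] [Fintype q] [DecidableEq p] [DecidableEq q]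
    (A : Matrix p q ℝ) : ‖A.transpose‖ = ‖A‖ := by
  have := Matrix.l2_opNorm_conjTranspose A
  rwa [Matrix.conjTranspose_eq_transpose_of_trivial] at this

theorem l2_opNorm_transpose_mul_self {p q : Type*} [Fintype p] [Fintype q] [DecidableEq p]
    [DecidableEq q] (A : Matrix p q ℝ) : ‖A.transpose * A‖ = ‖A‖ ^ 2 := by
  have := Matrix.l2_opNorm_conjTranspose_mul_self A
  rwa [Matrix.conjTranspose_eq_transpose_of_trivial, ← sq] at this

theorem l2_opNorm_le_one_of_transpose_mul_self {p q : Type*} [Fintype p] [Fintype q]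
    [DecidableEq q] {A : Matrix p q ℝ} (h : A.transpose * A = 1) : ‖A‖ ≤ 1 := by
  refine l2_opNorm_le_of_forall_dotProduct A zero_le_one fun x => ?_
  rw [dotProduct_mulVec_eq, Matrix.mulVec_mulVec, h, Matrix.one_mulVec]; simp

theorem l2_opNorm_one_le {q : Type*} [Fintype q] [DecidableEq q] :
    ‖(1 : Matrix q q ℝ)‖ ≤ 1 :=
  l2_opNorm_le_one_of_transpose_mul_self (by simp)

/-- A nonzero matrix has a top right singular vector. -/
theorem exists_top_singular_vector {m n : Type*} [Fintype m] [Fintype n] [DecidableEq n]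
    (S : Matrix m n ℝ) (hS : S ≠ 0) :
    ∃ x : n → ℝ, x ⬝ᵥ x = 1 ∧ (S.mulVec x) ⬝ᵥ (S.mulVec x) = ‖S‖ ^ 2 ∧
      S.transpose.mulVec (S.mulVec x) = ‖S‖ ^ 2 • x := by
  classical
  have hne : Nonempty n := by
    by_contra h
    rw [not_nonempty_iff] at h
    exact hS (Subsingleton.elim _ _)
  obtain ⟨x, hx, hmax⟩ := (isCompact_sphere (0 : EuclideanSpace ℝ n) 1).exists_isMaxOn
    (NormedSpace.sphere_nonempty.mpr zero_le_one)
    (f := fun x => ‖(Matrix.toEuclideanLin S).toContinuousLinearMap x‖)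
    (by fun_prop)
  have hx1 : ‖x‖ = 1 := by simpa using hx
  have hx2 : x.ofLp ⬝ᵥ x.ofLp = 1 := by
    rw [dotProduct_self_eq_norm_sq]; simp [hx1]
  have key : ‖S‖ = ‖(Matrix.toEuclideanLin S).toContinuousLinearMap x‖ := by
    apply le_antisymm
    · rw [Matrix.l2_opNorm_def]
      refine ContinuousLinearMap.opNorm_le_of_unit_norm (norm_nonneg _) fun y hy => ?_
      exact hmax (by simpa using hy)
    · rw [Matrix.l2_opNorm_def]
      simpa [hx1] using! ((Matrix.toEuclideanLin S).toContinuousLinearMap).le_opNorm x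
  have h2 : (S.mulVec x.ofLp) ⬝ᵥ (S.mulVec x.ofLp) = ‖S‖ ^ 2 := by
    rw [dotProduct_self_eq_norm_sq, key]; rfl
  refine ⟨x.ofLp, hx2, h2, ?_⟩
  have h3 := dotProduct_mulVec_self_le S.transpose (S.mulVec x.ofLp)
  rw [l2_opNorm_transpose, h2] at h3
  set y := S.transpose.mulVec (S.mulVec x.ofLp) with hy
  have h4 : y ⬝ᵥ x.ofLp = ‖S‖ ^ 2 := by
    rw [hy, ← dotProduct_mulVec_eq, h2]
  -- Equality in Cauchy–Schwarz forces `Sᵀ S x = ‖S‖² x`.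
  have h5 : (y - ‖S‖ ^ 2 • x.ofLp) ⬝ᵥ (y - ‖S‖ ^ 2 • x.ofLp) ≤ 0 := by
    simp only [sub_dotProduct, dotProduct_sub, smul_dotProduct, dotProduct_smul, smul_eq_mul, h4,
      dotProduct_comm x.ofLp y, hx2]
    nlinarith
  have h6 := le_antisymm h5 (dotProduct_self_nonneg_real _)
  rw [dotProduct_self_eq_zero] at h6
  exact sub_eq_zero.mp h6

/-- **Sylvester bound.** If the quadratic form of `A` is at least `a`, that of `X` is at most `b`
on the orthogonal complement of the columns of `V`, and the columns of `S` lie in that complement,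
then `S` is controlled by `S A - X S` with constant `1 / (a - b)`, independently of the
dimension: test the Sylvester expression on the top singular pair of `S`. -/
theorem sylvester_bound {p q : Type*} [Fintype p] [Fintype q] [DecidableEq q] [DecidableEq p]
    {V S : Matrix p q ℝ} {A : Matrix q q ℝ} {X : Matrix p p ℝ} {a b : ℝ}
    (hA : ∀ x, a * (x ⬝ᵥ x) ≤ x ⬝ᵥ A.mulVec x)
    (hX : ∀ w, V.transpose.mulVec w = 0 → w ⬝ᵥ X.mulVec w ≤ b * (w ⬝ᵥ w))
    (hS : V.transpose * S = 0) :
    (a - b) * ‖S‖ ≤ ‖S * A - X * S‖ := by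
  by_cases h0 : S = 0
  · simp [h0]
  obtain ⟨x, hx, hu, hs⟩ := exists_top_singular_vector S h0
  have hpos : 0 < ‖S‖ := norm_pos_iff.mpr h0
  set u := S.mulVec x with hudef
  have h1 := hX u (by rw [hudef, Matrix.mulVec_mulVec, hS, Matrix.zero_mulVec])
  have h2 := hA x
  have h3 : u ⬝ᵥ (S * A - X * S).mulVec x = ‖S‖ ^ 2 * (x ⬝ᵥ A.mulVec x) - u ⬝ᵥ X.mulVec u := by
    rw [Matrix.sub_mulVec, dotProduct_sub, ← Matrix.mulVec_mulVec, ← Matrix.mulVec_mulVec,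
      dotProduct_mulVec_eq S, hs, smul_dotProduct, smul_eq_mul]
  have h4 := dotProduct_sq_le u ((S * A - X * S).mulVec x)
  have h5 := dotProduct_mulVec_self_le (S * A - X * S) x
  rw [h3, hu] at h4
  rw [hx, mul_one] at h2 h5
  rw [hu] at h1
  have h6 : ‖S‖ ^ 2 * (a - b) ≤ ‖S‖ ^ 2 * (x ⬝ᵥ A.mulVec x) - u ⬝ᵥ X.mulVec u := by
    nlinarith [mul_le_mul_of_nonneg_left h2 (sq_nonneg ‖S‖)]
  have h7 : ‖S‖ ^ 2 * (x ⬝ᵥ A.mulVec x) - u ⬝ᵥ X.mulVec u ≤ ‖S‖ * ‖S * A - X * S‖ := by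
    refine le_of_sq_le_sq ?_ (by positivity)
    rw [mul_pow]
    exact h4.trans (mul_le_mul_of_nonneg_left h5 (sq_nonneg _))
  nlinarith [mul_pos hpos hpos]

/-- For positive semidefinite `H`, the factor `H + 1` in `H² - 1 = (H + 1)(H - 1)` does not
decrease norms. -/
theorem norm_sub_one_le_of_posSemidef {q : Type*} [Fintype q] [DecidableEq q] {H : Matrix q q ℝ}
    (hpos : ∀ x, 0 ≤ x ⬝ᵥ H.mulVec x) : ‖H - 1‖ ≤ ‖H * H - 1‖ := by
  refine l2_opNorm_le_of_forall_dotProduct _ (norm_nonneg _) fun x => ?_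
  refine le_trans ?_ (dotProduct_mulVec_self_le (H * H - 1) x)
  have h1 : H * H - 1 = (H + 1) * (H - 1) := by noncomm_ring
  rw [h1, ← Matrix.mulVec_mulVec]
  set y := (H - 1).mulVec x
  have h2 := hpos y
  have h3 := dotProduct_self_nonneg_real (H.mulVec y)
  rw [Matrix.add_mulVec, Matrix.one_mulVec]
  simp only [add_dotProduct, dotProduct_add, dotProduct_comm (H.mulVec y) y]
  linarith

/-- Neumann bound for the inverse of a matrix close to the identity. -/
theorem exists_inverse_of_norm_sub_one_lt {q : Type*} [Fintype q] [DecidableEq q]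
    {C : Matrix q q ℝ} {t : ℝ} (ht : ‖C - 1‖ ≤ t) (ht1 : t < 1) :
    ∃ G : Matrix q q ℝ, C * G = 1 ∧ G * C = 1 ∧ (1 - t) * ‖G‖ ≤ 1 := by
  have hinj : ∀ x, C.mulVec x = 0 → x = 0 := by
    intro x hx
    have h1 := dotProduct_mulVec_self_le (C - 1) x
    rw [Matrix.sub_mulVec, hx, Matrix.one_mulVec, zero_sub, neg_dotProduct, dotProduct_neg,
      neg_neg] at h1
    have h2 : ‖C - 1‖ ^ 2 < 1 := by
      have := norm_nonneg (C - 1)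
      nlinarith
    have h3 := dotProduct_self_nonneg_real x
    exact dotProduct_self_eq_zero.mp (le_antisymm (by nlinarith) h3)
  have hdet : IsUnit C.det := by
    rw [isUnit_iff_ne_zero]
    intro h
    obtain ⟨v, hv, hv'⟩ := Matrix.exists_mulVec_eq_zero_iff.mpr h
    exact hv (hinj v hv')
  refine ⟨C⁻¹, Matrix.mul_nonsing_inv C hdet, Matrix.nonsing_inv_mul C hdet, ?_⟩
  have h1 : C⁻¹ = 1 - (C - 1) * C⁻¹ := by
    rw [sub_mul, Matrix.mul_nonsing_inv C hdet]; simp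
  have h2 : ‖C⁻¹‖ ≤ 1 + t * ‖C⁻¹‖ := by
    calc ‖C⁻¹‖ = ‖1 - (C - 1) * C⁻¹‖ := by rw [← h1]
      _ ≤ ‖(1 : Matrix q q ℝ)‖ + ‖(C - 1) * C⁻¹‖ := norm_sub_le _ _
      _ ≤ 1 + t * ‖C⁻¹‖ := add_le_add l2_opNorm_one_le
        ((Matrix.l2_opNorm_mul _ _).trans (mul_le_mul_of_nonneg_right ht (norm_nonneg _)))
  linarith

/-! ### Eigenbases and leading invariant subspaces -/

theorem sortedEigenvalues_antitone {d : ℕ} {X : Matrix (Fin d) (Fin d) ℝ} (hX : X.IsHermitian) :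
    Antitone (sortedEigenvalues hX) := fun _ _ hij =>
  hX.eigenvalues₀_antitone (Fin.le_def.mpr (Fin.le_def.mp hij))

/-- Orthogonal diagonalization with the eigenvalues in decreasing order. -/
theorem exists_sorted_eigenbasis {d : ℕ} {X : Matrix (Fin d) (Fin d) ℝ} (hX : X.IsHermitian) :
    ∃ W : Matrix (Fin d) (Fin d) ℝ, W.transpose * W = 1 ∧ W * W.transpose = 1 ∧
      X * W = W * Matrix.diagonal (sortedEigenvalues hX) := by
  let σ : Fin d ≃ Fin d := (finCongr (Fintype.card_fin d).symm).trans
    (Fintype.equivOfCardEq (Fintype.card_fin _))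
  have hσ : ∀ j, hX.eigenvalues (σ j) = sortedEigenvalues hX j := by
    intro j
    simp [Matrix.IsHermitian.eigenvalues, sortedEigenvalues, σ]
  set W : Matrix (Fin d) (Fin d) ℝ :=
    Matrix.of fun i j => (hX.eigenvectorBasis (σ j)).ofLp i with hW
  have h1 : W.transpose * W = 1 := by
    ext i j
    have := orthonormal_iff_ite.mp hX.eigenvectorBasis.orthonormal (σ i) (σ j)
    simp only [EmbeddingLike.apply_eq_iff_eq] at this
    rw [Matrix.one_apply, ← this, Matrix.mul_apply, PiLp.inner_apply]
    simp [hW, mul_comm]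
  refine ⟨W, h1, mul_eq_one_comm.mp h1, ?_⟩
  ext i j
  have := congrFun (hX.mulVec_eigenvectorBasis (σ j)) i
  rw [Matrix.mul_diagonal, ← hσ]
  simpa [hW, Matrix.mul_apply, Matrix.mulVec, dotProduct, mul_comm] using this

theorem dotProduct_mulVec_eq_sum_of_eigenbasis {d : ℕ} {X W : Matrix (Fin d) (Fin d) ℝ}
    {l : Fin d → ℝ} (hWW : W * W.transpose = 1) (hXW : X * W = W * Matrix.diagonal l)
    (w : Fin d → ℝ) :
    w ⬝ᵥ X.mulVec w = ∑ j, l j * (W.transpose.mulVec w) j ^ 2 := by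
  have h1 : X = W * Matrix.diagonal l * W.transpose := by
    rw [← hXW, Matrix.mul_assoc, hWW, Matrix.mul_one]
  conv_lhs => rw [h1]
  rw [← Matrix.mulVec_mulVec, ← Matrix.mulVec_mulVec, dotProduct_mulVec_eq]
  simp only [dotProduct, Matrix.mulVec_diagonal]
  exact Finset.sum_congr rfl fun j _ => by ring

theorem dotProduct_self_eq_sum_of_orthogonal {d : ℕ} {W : Matrix (Fin d) (Fin d) ℝ}
    (hWW : W * W.transpose = 1) (w : Fin d → ℝ) :
    w ⬝ᵥ w = ∑ j, (W.transpose.mulVec w) j ^ 2 := by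
  have h := dotProduct_mulVec_eq_sum_of_eigenbasis (X := 1) (l := fun _ => 1) hWW (by simp) w
  simpa using h

/-- The columns of a leading basis are invariant under `X`, and the matrix `A` of `X` in that basis
has quadratic form at least any lower bound `a` of the leading eigenvalues. -/
theorem IsLeadingBasis.exists_compression {d r : ℕ} {X : Matrix (Fin d) (Fin d) ℝ}
    {hX : X.IsHermitian} {hrd : r ≤ d} {V : Matrix (Fin d) (Fin r) ℝ}
    (hV : IsLeadingBasis hX hrd V) {a : ℝ}
    (ha : ∀ j : Fin r, a ≤ sortedEigenvalues hX (Fin.castLE hrd j)) :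
    ∃ A : Matrix (Fin r) (Fin r) ℝ, X * V = V * A ∧ ∀ x, a * (x ⬝ᵥ x) ≤ x ⬝ᵥ A.mulVec x := by
  obtain ⟨-, U, hU, hXU⟩ := hV
  have hUU : U * U.transpose = 1 := (Matrix.mem_orthogonalGroup_iff _ _).mp hU
  refine ⟨U * Matrix.diagonal (fun j => sortedEigenvalues hX (Fin.castLE hrd j)) * U.transpose,
    ?_, fun x => ?_⟩
  · rw [← Matrix.mul_assoc, ← Matrix.mul_assoc, ← hXU, Matrix.mul_assoc, Matrix.mul_assoc, hUU,
      Matrix.mul_one]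
  · rw [dotProduct_mulVec_eq_sum_of_eigenbasis hUU (by
      rw [Matrix.mul_assoc, mul_eq_one_comm.mp hUU, Matrix.mul_one]),
      dotProduct_self_eq_sum_of_orthogonal hUU,
      Finset.mul_sum]
    exact Finset.sum_le_sum fun j _ => mul_le_mul_of_nonneg_right (ha j) (sq_nonneg _)

theorem sum_eq_sum_castLE {d r : ℕ} (hrd : r ≤ d) (f : Fin d → ℝ)
    (hf : ∀ i : Fin d, r ≤ i → f i = 0) : ∑ i, f i = ∑ i : Fin r, f (Fin.castLE hrd i) := by
  symm
  refine Fintype.sum_of_injective (Fin.castLE hrd) (Fin.castLE_injective hrd) _ _ ?_ fun _ => rfl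
  intro i hi
  refine hf i (not_lt.mp fun h => hi ⟨⟨i, h⟩, rfl⟩)

/-- With a spectral gap, the columns of a leading basis span the same space as the first `r`
eigenvectors, so on their orthogonal complement the quadratic form of `X` is at most
the `(r+1)`-st eigenvalue. -/
theorem IsLeadingBasis.form_le_of_orthogonal {d r : ℕ} {X : Matrix (Fin d) (Fin d) ℝ}
    {hX : X.IsHermitian} (hrd : r < d) (hr' : r - 1 < d)
    {V : Matrix (Fin d) (Fin r) ℝ}
    (hV : IsLeadingBasis hX hrd.le V)
    (hgap : sortedEigenvalues hX ⟨r, hrd⟩ < sortedEigenvalues hX ⟨r - 1, hr'⟩)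
    (w : Fin d → ℝ) (hw : V.transpose.mulVec w = 0) :
    w ⬝ᵥ X.mulVec w ≤ sortedEigenvalues hX ⟨r, hrd⟩ * (w ⬝ᵥ w) := by
  obtain ⟨hVV, U, hU, hXU⟩ := hV
  obtain ⟨W, hW, hWW, hXW⟩ := exists_sorted_eigenbasis hX
  have hUU : U.transpose * U = 1 := (Matrix.mem_orthogonalGroup_iff' _ _).mp hU
  have hanti := sortedEigenvalues_antitone hX
  set M := W.transpose * (V * U) with hM
  have hXt : X.transpose = X := by
    have := hX.eq
    rwa [Matrix.conjTranspose_eq_transpose_of_trivial] at this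
  have hcomm : Matrix.diagonal (sortedEigenvalues hX) * M =
      M * Matrix.diagonal (fun j : Fin r => sortedEigenvalues hX (Fin.castLE hrd.le j)) := by
    have h1 := congrArg Matrix.transpose hXW
    rw [Matrix.transpose_mul, Matrix.transpose_mul, Matrix.diagonal_transpose, hXt] at h1
    rw [hM, ← Matrix.mul_assoc, ← h1, Matrix.mul_assoc, hXU, ← Matrix.mul_assoc]
  have hzero : ∀ (i : Fin d) (j : Fin r), r ≤ i → M i j = 0 := by
    intro i j hi
    have h1 := congrFun (congrFun hcomm i) j
    rw [Matrix.diagonal_mul, Matrix.mul_diagonal] at h1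
    have h2 : sortedEigenvalues hX i ≤ sortedEigenvalues hX ⟨r, hrd⟩ := hanti hi
    have h3 : sortedEigenvalues hX ⟨r - 1, hr'⟩ ≤
        sortedEigenvalues hX (Fin.castLE hrd.le j) := hanti (by
      rw [Fin.le_def]; simp; omega)
    -- Eigenvectors of distinct eigenvalues are orthogonal.
    have h4 : (sortedEigenvalues hX (Fin.castLE hrd.le j) - sortedEigenvalues hX i) *
        M i j = 0 := by
      linarith
    rcases mul_eq_zero.mp h4 with h | h
    · linarith
    · exact h
  have hMM : M.transpose * M = 1 := by
    rw [hM, Matrix.transpose_mul, Matrix.transpose_mul, Matrix.transpose_transpose,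
      Matrix.mul_assoc, ← Matrix.mul_assoc W, hWW, Matrix.one_mul, Matrix.mul_assoc,
      ← Matrix.mul_assoc V.transpose, hVV, Matrix.one_mul, hUU]
  -- The rows of `M` beyond the first `r` vanish, so its top square block is already orthogonal.
  set M₁ : Matrix (Fin r) (Fin r) ℝ := Matrix.of fun i j => M (Fin.castLE hrd.le i) j with hM₁
  have hM₁M₁ : M₁.transpose * M₁ = 1 := by
    rw [← hMM]
    ext i j
    rw [Matrix.mul_apply, Matrix.mul_apply, sum_eq_sum_castLE hrd.le]
    · rfl
    · intro l hl
      rw [hzero l j hl, mul_zero]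
  set z := W.transpose.mulVec w with hz
  have hMz : M.transpose.mulVec z = 0 := by
    rw [hM, hz, Matrix.transpose_mul, Matrix.transpose_mul, Matrix.transpose_transpose,
      Matrix.mulVec_mulVec, Matrix.mul_assoc, hWW, Matrix.mul_one, ← Matrix.mulVec_mulVec, hw,
      Matrix.mulVec_zero]
  have hM₁z : M₁.transpose.mulVec (fun i => z (Fin.castLE hrd.le i)) = 0 := by
    rw [← hMz]
    ext j
    simp only [Matrix.mulVec, dotProduct]
    rw [sum_eq_sum_castLE hrd.le]
    · rfl
    · intro l hl
      rw [Matrix.transpose_apply, hzero l j hl, zero_mul]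
  have hz0 : (fun i => z (Fin.castLE hrd.le i)) = 0 := by
    have := congrArg M₁.mulVec hM₁z
    rwa [Matrix.mulVec_mulVec, mul_eq_one_comm.mp hM₁M₁, Matrix.one_mulVec,
      Matrix.mulVec_zero] at this
  rw [dotProduct_mulVec_eq_sum_of_eigenbasis hWW hXW, dotProduct_self_eq_sum_of_orthogonal hWW,
    Finset.mul_sum]
  refine Finset.sum_le_sum fun i _ => ?_
  by_cases hi : (i : ℕ) < r
  · have : z i = 0 := congrFun hz0 ⟨i, hi⟩
    rw [← hz, this]; simp
  · exact mul_le_mul_of_nonneg_right (hanti (not_lt.mp hi)) (sq_nonneg _)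

/-- **Weyl's inequality**, lower bound: if the form of `X` is at least `a` on an `r`-dimensional
space, some vector of that space is orthogonal to the first `r - 1` eigenvectors of `Y`. -/
theorem le_sortedEigenvalues_of_compression {d r : ℕ} (hr : 1 ≤ r) (hr' : r - 1 < d)
    {X Y : Matrix (Fin d) (Fin d) ℝ} (hY : Y.IsHermitian) {V : Matrix (Fin d) (Fin r) ℝ}
    {A : Matrix (Fin r) (Fin r) ℝ} {a : ℝ} (hV : V.transpose * V = 1) (hXV : X * V = V * A)
    (hA : ∀ x, a * (x ⬝ᵥ x) ≤ x ⬝ᵥ A.mulVec x) :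
    a - ‖Y - X‖ ≤ sortedEigenvalues hY ⟨r - 1, hr'⟩ := by
  obtain ⟨W, hW, hWW, hYW⟩ := exists_sorted_eigenbasis hY
  -- `N` maps an `r`-dimensional space to an `(r - 1)`-dimensional one, so it has a kernel.
  let N : Matrix (Fin (r - 1)) (Fin r) ℝ :=
    (W.transpose * V).submatrix (Fin.castLE (by omega)) id
  have hker : LinearMap.ker N.mulVecLin ≠ ⊥ :=
    LinearMap.ker_ne_bot_of_finrank_lt (by simp; omega)
  obtain ⟨x, hx, hx0⟩ := Submodule.exists_mem_ne_zero_of_ne_bot hker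
  have hNx : N.mulVec x = 0 := by simpa using hx
  set v := V.mulVec x with hv
  have hvv : v ⬝ᵥ v = x ⬝ᵥ x := by
    rw [hv, dotProduct_mulVec_eq, Matrix.mulVec_mulVec, hV, Matrix.one_mulVec]
  have hXv : v ⬝ᵥ X.mulVec v = x ⬝ᵥ A.mulVec x := by
    rw [hv, Matrix.mulVec_mulVec, hXV, ← Matrix.mulVec_mulVec, dotProduct_mulVec_eq,
      Matrix.mulVec_mulVec, hV, Matrix.one_mulVec]
  have hz : ∀ i : Fin d, (i : ℕ) < r - 1 → (W.transpose.mulVec v) i = 0 := by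
    intro i hi
    have := congrFun hNx ⟨i, hi⟩
    rw [hv, Matrix.mulVec_mulVec]
    exact this
  have hYv : v ⬝ᵥ Y.mulVec v ≤ sortedEigenvalues hY ⟨r - 1, hr'⟩ * (v ⬝ᵥ v) := by
    rw [dotProduct_mulVec_eq_sum_of_eigenbasis hWW hYW, dotProduct_self_eq_sum_of_orthogonal hWW,
      Finset.mul_sum]
    refine Finset.sum_le_sum fun i _ => ?_
    by_cases hi : (i : ℕ) < r - 1
    · rw [hz i hi]; simp
    · exact mul_le_mul_of_nonneg_right (sortedEigenvalues_antitone hY (not_lt.mp hi)) (sq_nonneg _)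
  have hE := (abs_le.mp (abs_dotProduct_mulVec_le (Y - X) v)).1
  rw [Matrix.sub_mulVec, dotProduct_sub, hXv] at hE
  have hpos : 0 < x ⬝ᵥ x :=
    lt_of_le_of_ne (dotProduct_self_nonneg_real x) fun h => hx0 (dotProduct_self_eq_zero.mp h.symm)
  rw [hvv] at hYv hE
  have := hA x
  nlinarith

theorem IsLeadingBasis.mul_orthogonal {d r : ℕ} {X : Matrix (Fin d) (Fin d) ℝ}
    {hX : X.IsHermitian} {hrd : r ≤ d} {V : Matrix (Fin d) (Fin r) ℝ}
    (hV : IsLeadingBasis hX hrd V) {Z : Matrix (Fin r) (Fin r) ℝ}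
    (hZ : Z ∈ Matrix.orthogonalGroup (Fin r) ℝ) : IsLeadingBasis hX hrd (V * Z) := by
  obtain ⟨hVV, U, hU, hXU⟩ := hV
  have hZ1 : Z * Z.transpose = 1 := (Matrix.mem_orthogonalGroup_iff _ _).mp hZ
  have hZ2 : Z.transpose * Z = 1 := (Matrix.mem_orthogonalGroup_iff' _ _).mp hZ
  refine ⟨?_, Z.transpose * U, mul_mem ?_ hU, ?_⟩
  · rw [Matrix.transpose_mul, Matrix.mul_assoc, ← Matrix.mul_assoc V.transpose, hVV,
      Matrix.one_mul, hZ2]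
  · rw [Matrix.mem_orthogonalGroup_iff]
    exact hZ2
  · rw [Matrix.mul_assoc V, ← Matrix.mul_assoc Z, hZ1, Matrix.one_mul, hXU]

/-! ### The orthogonal Procrustes problem -/

theorem frobeniusNorm_sq {p q : ℕ} (A : Matrix (Fin p) (Fin q) ℝ) :
    frobeniusNorm A ^ 2 = (A.transpose * A).trace := by
  have h : frobeniusNorm A ^ 2 = ∑ i, ∑ j, A i j ^ 2 :=
    Real.sq_sqrt (Finset.sum_nonneg fun i _ => Finset.sum_nonneg fun j _ => sq_nonneg _)
  rw [h, Finset.sum_comm]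
  simp [Matrix.trace, Matrix.mul_apply, sq]

/-- Only the trace term of `‖V Z - W‖_F²` depends on the orthogonal matrix `Z`. -/
theorem frobeniusNorm_mul_sub_sq {d r : ℕ} {V W : Matrix (Fin d) (Fin r) ℝ}
    (hV : V.transpose * V = 1) {Z : Matrix (Fin r) (Fin r) ℝ}
    (hZ : Z ∈ Matrix.orthogonalGroup (Fin r) ℝ) :
    frobeniusNorm (V * Z - W) ^ 2 =
      r + (W.transpose * W).trace - 2 * (W.transpose * V * Z).trace := by
  have hZ2 : Z.transpose * Z = 1 := (Matrix.mem_orthogonalGroup_iff' _ _).mp hZ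
  have h1 : (V * Z).transpose * (V * Z) = 1 := by
    rw [Matrix.transpose_mul, Matrix.mul_assoc, ← Matrix.mul_assoc V.transpose, hV,
      Matrix.one_mul, hZ2]
  have h2 : ((V * Z).transpose * W).trace = (W.transpose * V * Z).trace := by
    rw [← Matrix.trace_transpose, Matrix.transpose_mul, Matrix.transpose_transpose,
      Matrix.mul_assoc]
  rw [frobeniusNorm_sq, Matrix.transpose_sub, Matrix.sub_mul, Matrix.mul_sub, Matrix.mul_sub, h1,
    Matrix.trace_sub, Matrix.trace_sub, Matrix.trace_sub, h2, ← Matrix.mul_assoc, Matrix.trace_one,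
    Fintype.card_fin]
  ring

/-- The Householder reflection in the hyperplane orthogonal to `u`, for `u ≠ 0`. -/
noncomputable def householder {n : ℕ} (u : Fin n → ℝ) : Matrix (Fin n) (Fin n) ℝ :=
  1 - (2 / (u ⬝ᵥ u)) • Matrix.vecMulVec u u

theorem householder_mem {n : ℕ} {u : Fin n → ℝ} (hu : u ⬝ᵥ u ≠ 0) :
    householder u ∈ Matrix.orthogonalGroup (Fin n) ℝ := by
  rw [Matrix.mem_orthogonalGroup_iff]
  change householder u * (householder u).transpose = 1
  have h : (householder u).transpose = householder u := by
    simp [householder, Matrix.transpose_vecMulVec]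
  rw [h, householder, mul_sub, sub_mul, sub_mul, mul_one, one_mul, mul_one, Matrix.smul_mul,
    Matrix.mul_smul, Matrix.vecMulVec_mul_vecMulVec, Matrix.vecMulVec_smul, smul_smul, smul_smul]
  rw [show (2 / (u ⬝ᵥ u) * (2 / (u ⬝ᵥ u))) * (u ⬝ᵥ u) = 2 * (2 / (u ⬝ᵥ u)) by field_simp]
  rw [mul_smul, two_smul]
  abel

theorem trace_mul_vecMulVec {n : ℕ} (N : Matrix (Fin n) (Fin n) ℝ) (u v : Fin n → ℝ) :
    (N * Matrix.vecMulVec u v).trace = v ⬝ᵥ N.mulVec u := by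
  rw [Matrix.mul_vecMulVec, Matrix.trace_vecMulVec, dotProduct_comm]

/-- A matrix that maximizes `U ↦ tr (N U)` at `U = 1` over the orthogonal group is symmetric and
positive semidefinite: one reflection gives positivity, and products of two nearby
reflections give symmetry. -/
theorem posSemidef_of_trace_max {n : ℕ} {N : Matrix (Fin n) (Fin n) ℝ}
    (hN : ∀ U ∈ Matrix.orthogonalGroup (Fin n) ℝ, (N * U).trace ≤ N.trace) :
    N.transpose = N ∧ ∀ x, 0 ≤ x ⬝ᵥ N.mulVec x := by
  constructor
  · have key : ∀ u v : Fin n → ℝ, u ⬝ᵥ u ≠ 0 → v ⬝ᵥ v ≠ 0 →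
        2 * (u ⬝ᵥ v) * (v ⬝ᵥ N.mulVec u) ≤
          (v ⬝ᵥ v) * (u ⬝ᵥ N.mulVec u) + (u ⬝ᵥ u) * (v ⬝ᵥ N.mulVec v) := by
      intro u v hu hv
      have h := hN _ (mul_mem (householder_mem hu) (householder_mem hv))
      have hu' : 0 < u ⬝ᵥ u := lt_of_le_of_ne (dotProduct_self_nonneg_real u) hu.symm
      have hv' : 0 < v ⬝ᵥ v := lt_of_le_of_ne (dotProduct_self_nonneg_real v) hv.symm
      simp only [householder, mul_sub, sub_mul, mul_one, one_mul, Matrix.smul_mul,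
        Matrix.mul_smul, Matrix.vecMulVec_mul_vecMulVec, Matrix.vecMulVec_smul, Matrix.trace_sub,
        Matrix.trace_smul, trace_mul_vecMulVec, smul_eq_mul] at h
      have h2 : (2 / (u ⬝ᵥ u)) * (2 / (v ⬝ᵥ v)) * ((u ⬝ᵥ v) * (v ⬝ᵥ N.mulVec u)) ≤
          2 / (u ⬝ᵥ u) * (u ⬝ᵥ N.mulVec u) + 2 / (v ⬝ᵥ v) * (v ⬝ᵥ N.mulVec v) := by
        linarith
      have h3 := mul_le_mul_of_nonneg_left h2 (mul_pos hu' hv').le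
      field_simp at h3
      linarith
    ext a b
    by_cases hab : a = b
    · subst hab; rfl
    have hba : b ≠ a := fun h => hab h.symm
    rw [Matrix.transpose_apply]
    set p := N a a
    set q := N b b
    -- Reflect in the nearby directions `e_a` and `e_a + t e_b`; the linear term in `t` must vanish.
    have hquad : ∀ t : ℝ, t * (N b a - N a b) ≤ t ^ 2 * (p + q) := by
      intro t
      have h := key (Pi.single a 1) (Pi.single a 1 + t • Pi.single b 1) (by simp) (by
        simp [dotProduct_add, hab, hba]; nlinarith [sq_nonneg t])
      simp [add_dotProduct, dotProduct_add, Matrix.mulVec_add, Matrix.mulVec_smul, hab, hba] at h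
      simp only [p, q]
      nlinarith
    have h1 : N b a - N a b = 0 := by
      have hpq : 0 ≤ p + q := by
        have h1 := hquad 1
        have h2 := hquad (-1)
        linarith
      set D := N b a - N a b
      have h1 := hquad (D / (p + q + 1))
      have h2 : D ^ 2 * (p + q + 1) ≤ D ^ 2 * (p + q) := by
        field_simp at h1
        nlinarith
      nlinarith [sq_nonneg D]
    linarith
  · intro x
    by_cases hx : x ⬝ᵥ x = 0
    · rw [dotProduct_self_eq_zero.mp hx]; simp
    have h := hN _ (householder_mem hx)
    have hx' : 0 < x ⬝ᵥ x := lt_of_le_of_ne (dotProduct_self_nonneg_real x) (Ne.symm hx)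
    simp only [householder, mul_sub, mul_one, Matrix.mul_smul, Matrix.trace_sub,
      Matrix.trace_smul, trace_mul_vecMulVec, smul_eq_mul] at h
    have h2 : 0 ≤ 2 / (x ⬝ᵥ x) * (x ⬝ᵥ N.mulVec x) := by linarith
    exact nonneg_of_mul_nonneg_right h2 (by positivity)

theorem IsProcrustesSolution.posSemidef {d r : ℕ} {V W : Matrix (Fin d) (Fin r) ℝ}
    {Z : Matrix (Fin r) (Fin r) ℝ} (hV : V.transpose * V = 1)
    (h : IsProcrustesSolution V W Z) :
    (W.transpose * (V * Z)).transpose = W.transpose * (V * Z) ∧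
      ∀ x, 0 ≤ x ⬝ᵥ (W.transpose * (V * Z)).mulVec x := by
  refine posSemidef_of_trace_max fun U hU => ?_
  have h1 := h.2 (Z * U) (mul_mem h.1 hU)
  have h2 := pow_le_pow_left₀ (Real.sqrt_nonneg _) h1 2
  change frobeniusNorm _ ^ 2 ≤ frobeniusNorm _ ^ 2 at h2
  rw [frobeniusNorm_mul_sub_sq hV h.1, frobeniusNorm_mul_sub_sq hV (mul_mem h.1 hU)] at h2
  simp only [Matrix.mul_assoc] at h2 ⊢
  linarith

/-- A polar decomposition, obtained by maximizing `U ↦ tr (M U)` over the orthogonal group. -/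
theorem exists_orthogonal_mul_posSemidef {n : ℕ} (M : Matrix (Fin n) (Fin n) ℝ) :
    ∃ Z ∈ Matrix.orthogonalGroup (Fin n) ℝ,
      (M * Z).transpose = M * Z ∧ ∀ x, 0 ≤ x ⬝ᵥ (M * Z).mulVec x := by
  have hcompact : IsCompact (Matrix.orthogonalGroup (Fin n) ℝ :
      Set (Matrix (Fin n) (Fin n) ℝ)) := by
    have : ProperSpace (Matrix (Fin n) (Fin n) ℝ) := FiniteDimensional.proper ℝ _
    refine (isCompact_closedBall (0 : Matrix (Fin n) (Fin n) ℝ) 1).of_isClosed_subset ?_ ?_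
    · have : (Matrix.orthogonalGroup (Fin n) ℝ : Set (Matrix (Fin n) (Fin n) ℝ)) =
          {U | U * star U = 1} := by
        ext U; exact Matrix.mem_orthogonalGroup_iff _ _
      rw [this]
      exact isClosed_eq (by fun_prop) continuous_const
    · intro U hU
      rw [mem_closedBall_zero_iff]
      exact l2_opNorm_le_one_of_transpose_mul_self ((Matrix.mem_orthogonalGroup_iff' _ _).mp hU)
  obtain ⟨Z, hZ, hmax⟩ := hcompact.exists_isMaxOn ⟨1, one_mem _⟩
    (f := fun U => (M * U).trace) (by
      have : Continuous fun U : Matrix (Fin n) (Fin n) ℝ => (M * U).trace :=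
        ((Matrix.traceLinearMap (Fin n) ℝ ℝ).comp
          (LinearMap.mulLeft ℝ M)).continuous_of_finiteDimensional
      exact this.continuousOn)
  refine ⟨Z, hZ, posSemidef_of_trace_max fun U hU => ?_⟩
  rw [Matrix.mul_assoc]
  exact hmax (mul_mem hZ hU)

/-! ### The orthogonal complement of a column space -/

theorem l2_opNorm_mul_le_of_le {m n l : Type*} [Fintype m] [Fintype n] [Fintype l]
    [DecidableEq n] [DecidableEq l] {A : Matrix m n ℝ} {B : Matrix n l ℝ} {α β : ℝ}
    (hA : ‖A‖ ≤ α) (hB : ‖B‖ ≤ β) : ‖A * B‖ ≤ α * β :=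
  (Matrix.l2_opNorm_mul A B).trans
    (mul_le_mul hA hB (norm_nonneg _) ((norm_nonneg _).trans hA))

/-- For `V` with orthonormal columns, the orthogonal projection onto the orthogonal complement
of the column space. -/
def complProj {d r : ℕ} (V : Matrix (Fin d) (Fin r) ℝ) : Matrix (Fin d) (Fin d) ℝ :=
  1 - V * V.transpose

theorem complProj_transpose {d r : ℕ} (V : Matrix (Fin d) (Fin r) ℝ) :
    (complProj V).transpose = complProj V := by
  simp [complProj]

theorem transpose_mul_complProj {d r : ℕ} {V : Matrix (Fin d) (Fin r) ℝ}
    (hV : V.transpose * V = 1) : V.transpose * complProj V = 0 := by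
  rw [complProj, Matrix.mul_sub, ← Matrix.mul_assoc, hV, Matrix.one_mul, Matrix.mul_one, sub_self]

theorem complProj_mul_self {d r : ℕ} {V : Matrix (Fin d) (Fin r) ℝ}
    (hV : V.transpose * V = 1) : complProj V * V = 0 := by
  rw [complProj, Matrix.sub_mul, Matrix.mul_assoc, hV, Matrix.one_mul, Matrix.mul_one, sub_self]

theorem complProj_mul_complProj {d r : ℕ} {V : Matrix (Fin d) (Fin r) ℝ}
    (hV : V.transpose * V = 1) : complProj V * complProj V = complProj V := by
  have h : complProj V * complProj V =
      complProj V - V * (V.transpose * complProj V) := by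
    conv_lhs => enter [1]; rw [complProj]
    rw [Matrix.sub_mul, Matrix.one_mul, Matrix.mul_assoc]
  rw [h, transpose_mul_complProj hV, Matrix.mul_zero, sub_zero]

theorem norm_complProj_le {d r : ℕ} {V : Matrix (Fin d) (Fin r) ℝ}
    (hV : V.transpose * V = 1) : ‖complProj V‖ ≤ 1 := by
  have h := l2_opNorm_transpose_mul_self (complProj V)
  rw [complProj_transpose, complProj_mul_complProj hV] at h
  by_contra! hlt
  nlinarith

theorem mul_add_complProj_mul {d r s : ℕ} (V : Matrix (Fin d) (Fin r) ℝ)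
    (P : Matrix (Fin d) (Fin s) ℝ) : V * (V.transpose * P) + complProj V * P = P := by
  rw [complProj, Matrix.sub_mul, Matrix.mul_assoc, Matrix.one_mul]
  abel

/-- Pythagoras for the splitting of the columns along `V` and its complement. -/
theorem transpose_mul_eq_add_complProj {d r : ℕ} {V : Matrix (Fin d) (Fin r) ℝ}
    (hV : V.transpose * V = 1) (P R : Matrix (Fin d) (Fin r) ℝ) :
    P.transpose * R = (V.transpose * P).transpose * (V.transpose * R) +
      (complProj V * P).transpose * (complProj V * R) := by
  rw [Matrix.transpose_mul, Matrix.transpose_mul, Matrix.transpose_transpose, complProj_transpose,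
    Matrix.mul_assoc, Matrix.mul_assoc, ← Matrix.mul_assoc (complProj V),
    complProj_mul_complProj hV, ← Matrix.mul_add, mul_add_complProj_mul]

theorem transpose_mul_eq_of_invariant {d r : ℕ} {V : Matrix (Fin d) (Fin r) ℝ}
    {X : Matrix (Fin d) (Fin d) ℝ} {A : Matrix (Fin r) (Fin r) ℝ} (hV : V.transpose * V = 1)
    (hX : X.transpose = X) (hXV : X * V = V * A) : V.transpose * X = A * V.transpose := by
  have h1 : V.transpose * (X * V) = A := by
    rw [hXV, ← Matrix.mul_assoc, hV, Matrix.one_mul]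
  have h2 : A.transpose = A := by
    rw [← h1, Matrix.transpose_mul, Matrix.transpose_mul, hX, Matrix.transpose_transpose,
      Matrix.mul_assoc]
  have h3 := congrArg Matrix.transpose hXV
  rwa [Matrix.transpose_mul, Matrix.transpose_mul, hX, h2] at h3

theorem complProj_mul_comm {d r : ℕ} {V : Matrix (Fin d) (Fin r) ℝ}
    {X : Matrix (Fin d) (Fin d) ℝ} {A : Matrix (Fin r) (Fin r) ℝ} (hV : V.transpose * V = 1)
    (hX : X.transpose = X) (hXV : X * V = V * A) : complProj V * X = X * complProj V := by
  rw [complProj, Matrix.sub_mul, Matrix.mul_sub, Matrix.mul_assoc,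
    transpose_mul_eq_of_invariant hV hX hXV, ← Matrix.mul_assoc, ← hXV, Matrix.mul_assoc,
    Matrix.one_mul, Matrix.mul_one]

/-! ### Perturbation of one aligned basis -/

/-- The `sin Θ` bound for an invariant subspace of a perturbation `Y` of `X`. -/
theorem norm_complProj_mul_le {d r : ℕ} {V P : Matrix (Fin d) (Fin r) ℝ}
    {X Y : Matrix (Fin d) (Fin d) ℝ} {A B : Matrix (Fin r) (Fin r) ℝ} {a b : ℝ}
    (hV : V.transpose * V = 1) (hX : X.transpose = X) (hXV : X * V = V * A)
    (hXb : ∀ w, V.transpose.mulVec w = 0 → w ⬝ᵥ X.mulVec w ≤ b * (w ⬝ᵥ w))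
    (hP : P.transpose * P = 1) (hYP : Y * P = P * B)
    (hB : ∀ x, a * (x ⬝ᵥ x) ≤ x ⬝ᵥ B.mulVec x) :
    (a - b) * ‖complProj V * P‖ ≤ ‖Y - X‖ := by
  have h0 : V.transpose * (complProj V * P) = 0 := by
    rw [← Matrix.mul_assoc, transpose_mul_complProj hV, Matrix.zero_mul]
  refine (sylvester_bound hB hXb h0).trans ?_
  have h1 : complProj V * P * B - X * (complProj V * P) = complProj V * ((Y - X) * P) := by
    rw [Matrix.mul_assoc, ← hYP, ← Matrix.mul_assoc X, ← complProj_mul_comm hV hX hXV,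
      Matrix.mul_assoc, ← Matrix.mul_sub, Matrix.sub_mul]
  rw [h1]
  have h2 := l2_opNorm_mul_le_of_le (norm_complProj_le hV) (l2_opNorm_mul_le_of_le
    (le_refl ‖Y - X‖) (l2_opNorm_le_one_of_transpose_mul_self hP))
  simpa using h2

/-- If `R` is Procrustes-aligned with `V` and `P` is Procrustes-aligned with `R`, then `Vᵀ P` is
the identity up to second order in the distances of `P` and `R` to the column space of `V`. -/
theorem norm_transpose_mul_sub_one_le {d r : ℕ} {V P R : Matrix (Fin d) (Fin r) ℝ} {s : ℝ}
    (hV : V.transpose * V = 1) (hP : P.transpose * P = 1) (hR : R.transpose * R = 1)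
    (hPs : ‖complProj V * P‖ ≤ s) (hRs : ‖complProj V * R‖ ≤ s)
    (hVR : (V.transpose * R).transpose = V.transpose * R)
    (hVRpos : ∀ x, 0 ≤ x ⬝ᵥ (V.transpose * R).mulVec x)
    (hRP : (R.transpose * P).transpose = R.transpose * P)
    (hRPpos : ∀ x, 0 ≤ x ⬝ᵥ (R.transpose * P).mulVec x) :
    ‖V.transpose * P - 1‖ ≤ 7 * s ^ 2 := by
  have hs : 0 ≤ s := (norm_nonneg _).trans hPs
  have hPP := transpose_mul_eq_add_complProj hV P P
  have hRR := transpose_mul_eq_add_complProj hV R R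
  have hRP' := transpose_mul_eq_add_complProj hV R P
  have hV1 : ‖V.transpose‖ ≤ 1 := by
    rw [l2_opNorm_transpose]; exact l2_opNorm_le_one_of_transpose_mul_self hV
  have hR1 : ‖R.transpose‖ ≤ 1 := by
    rw [l2_opNorm_transpose]; exact l2_opNorm_le_one_of_transpose_mul_self hR
  have hP1 := l2_opNorm_le_one_of_transpose_mul_self hP
  have hH1 : ‖R.transpose * P‖ ≤ 1 := by simpa using l2_opNorm_mul_le_of_le hR1 hP1
  have hC1 : ‖V.transpose * P‖ ≤ 1 := by simpa using l2_opNorm_mul_le_of_le hV1 hP1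
  have hSt : ‖(complProj V * R).transpose‖ ≤ s := by rwa [l2_opNorm_transpose]
  rw [hP] at hPP
  rw [hR, hVR] at hRR
  rw [hVR] at hRP'
  set H := R.transpose * P
  set C := V.transpose * P
  set D := V.transpose * R
  set S := complProj V * P
  set T := complProj V * R
  have hD : ‖D - 1‖ ≤ s ^ 2 := by
    refine (norm_sub_one_le_of_posSemidef hVRpos).trans ?_
    have : D * D - 1 = -(T.transpose * T) := by rw [hRR]; abel
    rw [this, norm_neg, l2_opNorm_transpose_mul_self]
    exact pow_le_pow_left₀ (norm_nonneg _) hRs 2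
  have hHC : ‖H - C‖ ≤ 2 * s ^ 2 := by
    have : H - C = (D - 1) * C + T.transpose * S := by rw [hRP']; noncomm_ring
    rw [this]
    refine (norm_add_le _ _).trans ?_
    have h1 := l2_opNorm_mul_le_of_le hD hC1
    have h2 := l2_opNorm_mul_le_of_le hSt hPs
    linarith
  have hHH : ‖H * H - 1‖ ≤ 5 * s ^ 2 := by
    have h0 : H * H - 1 = H.transpose * (H - C) + (H - C).transpose * C - S.transpose * S := by
      rw [hPP, Matrix.mul_sub, Matrix.transpose_sub, Matrix.sub_mul, hRP]
      abel
    rw [h0]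
    have hHt : ‖H.transpose‖ ≤ 1 := by rwa [hRP]
    have hHCt : ‖(H - C).transpose‖ ≤ 2 * s ^ 2 := by rwa [l2_opNorm_transpose]
    have h1 := l2_opNorm_mul_le_of_le hHt hHC
    have h2 := l2_opNorm_mul_le_of_le hHCt hC1
    have h3 : ‖S.transpose * S‖ ≤ s ^ 2 := by
      rw [l2_opNorm_transpose_mul_self]
      exact pow_le_pow_left₀ (norm_nonneg _) hPs 2
    have h4 := norm_sub_le (H.transpose * (H - C) + (H - C).transpose * C) (S.transpose * S)
    have h5 := norm_add_le (H.transpose * (H - C)) ((H - C).transpose * C)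
    linarith
  have h1 := norm_sub_one_le_of_posSemidef hRPpos
  have h2 : C - 1 = (H - 1) - (H - C) := by abel
  rw [h2]
  have := norm_sub_le (H - 1) (H - C)
  linarith

/-- The Riccati equation of a perturbed invariant subspace: in the coordinates `P G = V + Y` with
`G = (Vᵀ P)⁻¹` and `Vᵀ Y = 0`, the Sylvester expression of `Y` is `(1 - V Vᵀ) E V` up to terms
containing both `E` and `Y`. No norm of `X` enters. -/
theorem riccati_identity {d r : ℕ} {V P : Matrix (Fin d) (Fin r) ℝ}
    {X E : Matrix (Fin d) (Fin d) ℝ} {A B G : Matrix (Fin r) (Fin r) ℝ}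
    (hV : V.transpose * V = 1) (hX : X.transpose = X) (hXV : X * V = V * A)
    (hP : (X + E) * P = P * B) (hCG : V.transpose * P * G = 1)
    (hGC : G * (V.transpose * P) = 1) :
    let Y := complProj V * P * G
    Y * A - X * Y = complProj V * E * V + complProj V * E * Y - Y * V.transpose * E * (V + Y) := by
  intro Y
  have hPG : P * G = V + Y := by
    conv_lhs => rw [← mul_add_complProj_mul V P]
    rw [Matrix.add_mul, Matrix.mul_assoc V, hCG, Matrix.mul_one]
  have hSB : complProj V * P * B * G = X * Y + complProj V * E * (V + Y) := by
    rw [Matrix.mul_assoc (complProj V), ← hP, Matrix.add_mul, Matrix.mul_add, ← Matrix.mul_assoc,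
      complProj_mul_comm hV hX hXV, Matrix.add_mul, ← hPG]
    simp only [Y, Matrix.mul_assoc]
  have hCB : V.transpose * P * B = A * (V.transpose * P) + V.transpose * E * P := by
    rw [Matrix.mul_assoc, ← hP, Matrix.add_mul, Matrix.mul_add, ← Matrix.mul_assoc,
      transpose_mul_eq_of_invariant hV hX hXV, Matrix.mul_assoc, Matrix.mul_assoc]
  have hA : A = V.transpose * P * B * G - V.transpose * E * (V + Y) := by
    rw [hCB, Matrix.add_mul, Matrix.mul_assoc A, hCG, Matrix.mul_one, Matrix.mul_assoc _ P, hPG,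
      add_sub_cancel_right]
  have hYC : Y * (V.transpose * P) = complProj V * P := by
    rw [Matrix.mul_assoc, hGC, Matrix.mul_one]
  have hYA : Y * A = complProj V * P * B * G - Y * V.transpose * E * (V + Y) := by
    conv_lhs => rw [hA]
    rw [Matrix.mul_sub, ← hYC]
    simp only [Matrix.mul_assoc]
  rw [hYA, hSB, Matrix.mul_add]
  abel

/-- First-order expansion of an aligned basis `P` of `X + E`: up to second order it is `V + Y`,
where `Y` solves the linearized equation `Y A - X Y = (1 - V Vᵀ) E V` up to second order. -/
theorem exists_first_order_expansion {d r : ℕ} {V P R : Matrix (Fin d) (Fin r) ℝ}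
    {X E : Matrix (Fin d) (Fin d) ℝ} {A B : Matrix (Fin r) (Fin r) ℝ} {δ ε : ℝ}
    (hδ : 0 < δ) (hε8 : ε ≤ 1 / 8)
    (hV : V.transpose * V = 1) (hX : X.transpose = X) (hXV : X * V = V * A)
    (hE : ‖E‖ ≤ ε * δ)
    (hP : P.transpose * P = 1) (hR : R.transpose * R = 1) (hXP : (X + E) * P = P * B)
    (hPs : ‖complProj V * P‖ ≤ 8 / 7 * ε) (hRs : ‖complProj V * R‖ ≤ 8 / 7 * ε)
    (hVR : (V.transpose * R).transpose = V.transpose * R)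
    (hVRpos : ∀ x, 0 ≤ x ⬝ᵥ (V.transpose * R).mulVec x)
    (hRP : (R.transpose * P).transpose = R.transpose * P)
    (hRPpos : ∀ x, 0 ≤ x ⬝ᵥ (R.transpose * P).mulVec x) :
    ∃ Y : Matrix (Fin d) (Fin r) ℝ, V.transpose * Y = 0 ∧ ‖P - V - Y‖ ≤ 11 * ε ^ 2 ∧
      ‖Y * A - X * Y - complProj V * E * V‖ ≤ 3 * ε ^ 2 * δ := by
  have hε : 0 ≤ ε := by
    have := (norm_nonneg _).trans hPs
    linarith
  have hC := norm_transpose_mul_sub_one_le hV hP hR hPs hRs hVR hVRpos hRP hRPpos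
  have hC7 : ‖V.transpose * P - 1‖ ≤ 1 / 7 := hC.trans (by nlinarith)
  obtain ⟨G, hCG, hGC, hG⟩ := exists_inverse_of_norm_sub_one_lt hC7 (by norm_num)
  have hG' : ‖G‖ ≤ 7 / 6 := by linarith
  have hric := riccati_identity hV hX hXV hXP hCG hGC
  simp only at hric
  have hYC : complProj V * P * G * (V.transpose * P) = complProj V * P := by
    rw [Matrix.mul_assoc, hGC, Matrix.mul_one]
  have hY : ‖complProj V * P * G‖ ≤ 4 / 3 * ε :=
    (l2_opNorm_mul_le_of_le hPs hG').trans (by linarith)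
  have hVY : V.transpose * (complProj V * P * G) = 0 := by
    rw [← Matrix.mul_assoc, ← Matrix.mul_assoc, transpose_mul_complProj hV, Matrix.zero_mul,
      Matrix.zero_mul]
  have hV1 := l2_opNorm_le_one_of_transpose_mul_self hV
  have hVt1 : ‖V.transpose‖ ≤ 1 := by rwa [l2_opNorm_transpose]
  have hQ := norm_complProj_le hV
  have hsplit := mul_add_complProj_mul V P
  set Y := complProj V * P * G
  have hVY1 : ‖V + Y‖ ≤ 1 + 4 / 3 * ε := (norm_add_le _ _).trans (by linarith)
  refine ⟨Y, hVY, ?_, ?_⟩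
  · have h1 : P - V - Y = (V + Y) * (V.transpose * P - 1) := by
      rw [Matrix.mul_sub, Matrix.add_mul, hYC, hsplit, Matrix.mul_one]
      abel
    rw [h1]
    refine (l2_opNorm_mul_le_of_le hVY1 hC).trans ?_
    nlinarith [mul_nonneg (sq_nonneg ε) (sub_nonneg.mpr hε8)]
  · rw [hric]
    have h1 : complProj V * E * V + complProj V * E * Y - Y * V.transpose * E * (V + Y) -
        complProj V * E * V = complProj V * E * Y - Y * V.transpose * E * (V + Y) := by abel
    rw [h1]
    have h2 := l2_opNorm_mul_le_of_le (l2_opNorm_mul_le_of_le hQ hE) hY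
    have h3 := l2_opNorm_mul_le_of_le (l2_opNorm_mul_le_of_le (l2_opNorm_mul_le_of_le hY hVt1) hE)
      hVY1
    have h4 := norm_sub_le (complProj V * E * Y) (Y * V.transpose * E * (V + Y))
    have h5 : 0 ≤ ε ^ 2 * δ * (1 / 8 - ε) :=
      mul_nonneg (mul_nonneg (sq_nonneg ε) hδ.le) (sub_nonneg.mpr hε8)
    have h6 : 0 ≤ ε ^ 2 * δ := mul_nonneg (sq_nonneg ε) hδ.le
    nlinarith

/-! ### Averages -/

theorem matrixAverage_sub {m p q : ℕ} (A B : Fin m → Matrix (Fin p) (Fin q) ℝ) :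
    matrixAverage (fun i => A i - B i) = matrixAverage A - matrixAverage B := by
  simp [matrixAverage, Finset.sum_sub_distrib, smul_sub]

theorem matrixAverage_const {m p q : ℕ} (hm : m ≠ 0) (A : Matrix (Fin p) (Fin q) ℝ) :
    matrixAverage (fun _ : Fin m => A) = A := by
  rw [matrixAverage, Finset.sum_const, Finset.card_univ, Fintype.card_fin,
    ← Nat.cast_smul_eq_nsmul ℝ,
    smul_smul, inv_mul_cancel₀ (Nat.cast_ne_zero.mpr hm), one_smul]

theorem matrixAverage_mul {m p q s : ℕ} (A : Fin m → Matrix (Fin p) (Fin q) ℝ)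
    (N : Matrix (Fin q) (Fin s) ℝ) :
    matrixAverage (fun i => A i * N) = matrixAverage A * N := by
  rw [matrixAverage, matrixAverage, Matrix.smul_mul, Matrix.sum_mul]

theorem mul_matrixAverage {m p q s : ℕ} (A : Fin m → Matrix (Fin p) (Fin q) ℝ)
    (N : Matrix (Fin s) (Fin p) ℝ) :
    matrixAverage (fun i => N * A i) = N * matrixAverage A := by
  rw [matrixAverage, matrixAverage, Matrix.mul_smul, Matrix.mul_sum]

theorem norm_matrixAverage_le {m p q : ℕ} (hm : m ≠ 0) (A : Fin m → Matrix (Fin p) (Fin q) ℝ)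
    {c : ℝ} (h : ∀ i, ‖A i‖ ≤ c) : ‖matrixAverage A‖ ≤ c := by
  have hm' : (0 : ℝ) < m := Nat.cast_pos.mpr (Nat.pos_of_ne_zero hm)
  have h1 : ‖∑ i, A i‖ ≤ m * c := by
    simpa using norm_sum_le_of_le Finset.univ (f := A) (n := fun _ => c) fun i _ => h i
  rw [matrixAverage, norm_smul, norm_inv, Real.norm_natCast, inv_mul_le_iff₀ hm']
  exact h1

/-! ### The averaged aligned bases -/

/-- Averaging the first-order expansions of the aligned bases: the linear terms average to a
solution of the Sylvester equation for the mean perturbation, so only that mean enters to first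
order. -/
theorem norm_matrixAverage_sub_le {m d r : ℕ} (hr : 1 ≤ r) (hrd : r < d)
    (hr' : r - 1 < d) {δ ε : ℝ} (hδ : 0 < δ)
    {X : Matrix (Fin d) (Fin d) ℝ} {Xhat : Fin m → Matrix (Fin d) (Fin d) ℝ}
    {hX : X.IsHermitian} {hXhat : ∀ i, (Xhat i).IsHermitian}
    (hgap : δ ≤ sortedEigenvalues hX ⟨r - 1, hr'⟩ - sortedEigenvalues hX ⟨r, hrd⟩)
    (hE : ∀ i, ‖Xhat i - X‖ ≤ ε * δ) (hε8 : ε ≤ 1 / 8)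
    {V : Matrix (Fin d) (Fin r) ℝ} (hV : IsLeadingBasis hX hrd.le V)
    {R : Matrix (Fin d) (Fin r) ℝ} (k : Fin m) (hR : IsLeadingBasis (hXhat k) hrd.le R)
    {P : Fin m → Matrix (Fin d) (Fin r) ℝ} (hP : ∀ i, IsLeadingBasis (hXhat i) hrd.le (P i))
    (hVR : (V.transpose * R).transpose = V.transpose * R)
    (hVRpos : ∀ x, 0 ≤ x ⬝ᵥ (V.transpose * R).mulVec x)
    (hRP : ∀ i, (R.transpose * P i).transpose = R.transpose * P i)
    (hRPpos : ∀ i x, 0 ≤ x ⬝ᵥ (R.transpose * P i).mulVec x) :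
    ‖matrixAverage P - V‖ ≤ 14 * ε ^ 2 + 1 / δ * ‖matrixAverage Xhat - X‖ := by
  have hm : m ≠ 0 := by rintro rfl; exact k.elim0
  have hXt : X.transpose = X := by
    have := hX.eq
    rwa [Matrix.conjTranspose_eq_transpose_of_trivial] at this
  obtain ⟨A, hXV, hA⟩ := hV.exists_compression (a := sortedEigenvalues hX ⟨r - 1, hr'⟩)
    fun j => sortedEigenvalues_antitone hX (by rw [Fin.le_def]; simp; omega)
  have hXb := hV.form_le_of_orthogonal hrd hr' (by linarith)
  set a := sortedEigenvalues hX ⟨r - 1, hr'⟩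
  set b := sortedEigenvalues hX ⟨r, hrd⟩
  have hinv : ∀ (i : Fin m) (W : Matrix (Fin d) (Fin r) ℝ), IsLeadingBasis (hXhat i) hrd.le W →
      ‖complProj V * W‖ ≤ 8 / 7 * ε ∧
        ∃ B : Matrix (Fin r) (Fin r) ℝ, Xhat i * W = W * B := by
    intro i W hW
    have hweyl := le_sortedEigenvalues_of_compression hr hr' (hXhat i) hV.1 hXV hA
    obtain ⟨B, hWB, hB⟩ := hW.exists_compression (a := a - ε * δ) fun j =>
      (show a - ε * δ ≤ sortedEigenvalues (hXhat i) ⟨r - 1, hr'⟩ by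
        linarith [hE i]).trans
        (sortedEigenvalues_antitone (hXhat i) (by rw [Fin.le_def]; simp; omega))
    refine ⟨?_, B, hWB⟩
    have h1 := (norm_complProj_mul_le hV.1 hXt hXV hXb hW.1 hWB hB).trans (hE i)
    have h2 : 7 / 8 * δ ≤ a - ε * δ - b := by nlinarith
    have h3 := mul_le_mul_of_nonneg_right h2 (norm_nonneg (complProj V * W))
    have h4 : δ * (7 / 8 * ‖complProj V * W‖) ≤ δ * ε := by linarith
    have h5 := le_of_mul_le_mul_left h4 hδ
    linarith
  have hexp : ∀ i, ∃ Y : Matrix (Fin d) (Fin r) ℝ, V.transpose * Y = 0 ∧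
      ‖P i - V - Y‖ ≤ 11 * ε ^ 2 ∧
      ‖Y * A - X * Y - complProj V * (Xhat i - X) * V‖ ≤ 3 * ε ^ 2 * δ := by
    intro i
    obtain ⟨hPs, B, hPB⟩ := hinv i (P i) (hP i)
    exact exists_first_order_expansion (B := B) hδ hε8 hV.1 hXt hXV (hE i) (hP i).1 hR.1
      (by rw [add_sub_cancel, hPB]) hPs (hinv k R hR).1 hVR hVRpos (hRP i) (hRPpos i)
  choose Y hVY hPY hYlin using hexp
  have h1 := norm_matrixAverage_le hm _ hPY
  have h2 := norm_matrixAverage_le hm _ hYlin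
  rw [matrixAverage_sub, matrixAverage_sub, matrixAverage_const hm] at h1
  rw [matrixAverage_sub, matrixAverage_sub, matrixAverage_mul, mul_matrixAverage,
    matrixAverage_mul (fun i => complProj V * (Xhat i - X)), mul_matrixAverage,
    matrixAverage_sub, matrixAverage_const hm] at h2
  have h3 : V.transpose * matrixAverage Y = 0 := by
    rw [← mul_matrixAverage]
    simp only [hVY]
    exact matrixAverage_const hm 0
  have h4 := sylvester_bound hA hXb h3
  have h5 : ‖complProj V * (matrixAverage Xhat - X) * V‖ ≤ ‖matrixAverage Xhat - X‖ := by
    simpa using l2_opNorm_mul_le_of_le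
      (l2_opNorm_mul_le_of_le (norm_complProj_le hV.1) (le_refl ‖matrixAverage Xhat - X‖))
      (l2_opNorm_le_one_of_transpose_mul_self hV.1)
  set Ybar := matrixAverage Y
  set Ebar := matrixAverage Xhat - X
  have h6 : ‖Ybar * A - X * Ybar‖ ≤ 3 * ε ^ 2 * δ + ‖Ebar‖ := by
    have := norm_add_le (Ybar * A - X * Ybar - complProj V * Ebar * V) (complProj V * Ebar * V)
    rw [sub_add_cancel] at this
    linarith
  have h7 : ‖Ybar‖ ≤ 3 * ε ^ 2 + 1 / δ * ‖Ebar‖ := by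
    have h8 := mul_le_mul_of_nonneg_right hgap (norm_nonneg Ybar)
    refine le_of_mul_le_mul_left (le_trans (h8.trans (h4.trans h6)) (le_of_eq ?_)) hδ
    field_simp
  have h8 := norm_add_le (matrixAverage P - V - Ybar) Ybar
  rw [sub_add_cancel] at h8
  linarith

/-! ### Orthonormalization -/

/-- If `Q R` is close to `V`, then the column spaces of `Q` and `V` are close. When the error `η`
is at least `1 / 2` the bound is trivial; otherwise `R` is invertible with a bounded inverse. -/
theorem dist₂_le_of_norm_sub_le {d r : ℕ} {Q V : Matrix (Fin d) (Fin r) ℝ}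
    {R : Matrix (Fin r) (Fin r) ℝ} {η : ℝ} (hQ : Q.transpose * Q = 1) (hV : V.transpose * V = 1)
    (h : ‖Q * R - V‖ ≤ η) : dist₂ Q V ≤ 4 * η := by
  have hη : 0 ≤ η := (norm_nonneg _).trans h
  have hQ1 := l2_opNorm_le_one_of_transpose_mul_self hQ
  have hV1 := l2_opNorm_le_one_of_transpose_mul_self hV
  have hQt : ‖Q.transpose‖ ≤ 1 := by rwa [l2_opNorm_transpose]
  have hVt : ‖V.transpose‖ ≤ 1 := by rwa [l2_opNorm_transpose]
  rw [dist₂]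
  by_cases hη2 : 1 / 2 ≤ η
  · have h1 := norm_sub_le (Q * Q.transpose) (V * V.transpose)
    have h2 := l2_opNorm_mul_le_of_le hQ1 hQt
    have h3 := l2_opNorm_mul_le_of_le hV1 hVt
    linarith
  push Not at hη2
  have hC : ‖V.transpose * (Q * R) - 1‖ ≤ η := by
    rw [← hV, ← Matrix.mul_sub]
    simpa using l2_opNorm_mul_le_of_le hVt h
  obtain ⟨G, -, hGC, hG⟩ := exists_inverse_of_norm_sub_one_lt hC (by linarith)
  have hG2 : ‖G‖ ≤ 2 := by nlinarith [norm_nonneg G]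
  set K := G * V.transpose * Q with hK
  have hRK : R * K = 1 := by
    refine mul_eq_one_comm.mp ?_
    rw [hK, ← hGC]
    simp only [Matrix.mul_assoc]
  have hK2 : ‖K‖ ≤ 2 := by
    simpa using l2_opNorm_mul_le_of_le (l2_opNorm_mul_le_of_le hG2 hVt) hQ1
  have h1 : ‖complProj V * Q‖ ≤ η * 2 := by
    have : complProj V * Q = complProj V * (Q * R - V) * K := by
      rw [Matrix.mul_sub, complProj_mul_self hV, sub_zero, Matrix.mul_assoc, Matrix.mul_assoc, hRK,
        Matrix.mul_one]
    rw [this]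
    simpa using l2_opNorm_mul_le_of_le (l2_opNorm_mul_le_of_le (norm_complProj_le hV) h) hK2
  have h2 : ‖complProj Q * V‖ ≤ η := by
    have : complProj Q * V = -(complProj Q * (Q * R - V)) := by
      rw [Matrix.mul_sub, ← Matrix.mul_assoc, complProj_mul_self hQ, Matrix.zero_mul, zero_sub,
        neg_neg]
    rw [this, norm_neg]
    simpa using l2_opNorm_mul_le_of_le (norm_complProj_le hQ) h
  have h3 : Q * Q.transpose - V * V.transpose =
      complProj V * Q * Q.transpose - V * (complProj Q * V).transpose := by
    rw [Matrix.transpose_mul, complProj_transpose, complProj, complProj]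
    simp only [Matrix.sub_mul, Matrix.mul_sub, Matrix.one_mul, Matrix.mul_one, Matrix.mul_assoc]
    abel
  rw [h3]
  have h4 := l2_opNorm_mul_le_of_le h1 hQt
  have h5 := l2_opNorm_mul_le_of_le hV1
    (show ‖(complProj Q * V).transpose‖ ≤ η by rwa [l2_opNorm_transpose])
  have h6 := norm_sub_le (complProj V * Q * Q.transpose) (V * (complProj Q * V).transpose)
  linarith

/-! ### Procrustes fixing -/

theorem mainTheorem1 :
    ∃ c : ℝ, 0 < c ∧
      ∀ (m d r : ℕ) (hr : 1 ≤ r) (hrd : r < d) (δ : ℝ) (_ : 0 < δ)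
        (X : Matrix (Fin d) (Fin d) ℝ) (Xhat : Fin m → Matrix (Fin d) (Fin d) ℝ)
        (hX : X.IsHermitian) (hXhat : ∀ i, (Xhat i).IsHermitian)
        (_ : δ ≤ sortedEigenvalues hX ⟨r - 1, by omega⟩ - sortedEigenvalues hX ⟨r, hrd⟩)
        (_ : ∀ i, ‖Xhat i - X‖ < δ / 8)
        (V₁ : Matrix (Fin d) (Fin r) ℝ) (_ : IsLeadingBasis hX hrd.le V₁)
        (Vloc : Fin m → Matrix (Fin d) (Fin r) ℝ)
        (_ : ∀ i, IsLeadingBasis (hXhat i) hrd.le (Vloc i))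
        (k : Fin m)
        (Valigned : Fin m → Matrix (Fin d) (Fin r) ℝ) (Vout : Matrix (Fin d) (Fin r) ℝ)
        (_ : IsProcrustesFixingRun Vloc (Vloc k) Valigned Vout),
        (IsProcrustesSolution (Vloc k) V₁ 1 →
          ‖matrixAverage Valigned - V₁‖ ≤
            c * (1 / δ ^ 2 * (⨆ i, ‖Xhat i - X‖ ^ 2) + 1 / δ * ‖matrixAverage Xhat - X‖)) ∧
        dist₂ Vout V₁ ≤
          c * (1 / δ ^ 2 * (⨆ i, ‖Xhat i - X‖ ^ 2) + 1 / δ * ‖matrixAverage Xhat - X‖) := by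
  -- The aligned average has error at most `14` times the bound, and orthonormalization costs a
  -- factor `4`.
  refine ⟨56, by norm_num, ?_⟩
  intro m d r hr hrd δ hδ X Xhat hX hXhat hgap hE V₁ hV₁ Vloc hVloc k Valigned Vout hrun
  -- With `s` the largest squared error, the lemmas above apply with `ε = √s / δ`.
  set s : ℝ := ⨆ i, ‖Xhat i - X‖ ^ 2 with hs
  have hle : ∀ i, ‖Xhat i - X‖ ^ 2 ≤ s := fun i =>
    le_ciSup (f := fun i => ‖Xhat i - X‖ ^ 2) (Set.finite_range _).bddAbove i
  have hs0 : 0 ≤ s := (sq_nonneg _).trans (hle k)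
  have : Nonempty (Fin m) := ⟨k⟩
  have hs8 : s ≤ (δ / 8) ^ 2 :=
    ciSup_le fun i => pow_le_pow_left₀ (norm_nonneg _) (hE i).le 2
  have hEε : ∀ i, ‖Xhat i - X‖ ≤ Real.sqrt s / δ * δ := fun i => by
    rw [div_mul_cancel₀ _ hδ.ne']
    exact Real.le_sqrt_of_sq_le (hle i)
  have hε8 : Real.sqrt s / δ ≤ 1 / 8 := by
    rw [div_le_iff₀ hδ]
    exact (Real.sqrt_le_iff.mpr ⟨by positivity, hs8⟩).trans (by linarith)
  have hε2 : (Real.sqrt s / δ) ^ 2 = 1 / δ ^ 2 * s := by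
    rw [div_pow, Real.sq_sqrt hs0]; ring
  have hsδ : 0 ≤ 1 / δ ^ 2 * s := by positivity
  have hEδ : 0 ≤ 1 / δ * ‖matrixAverage Xhat - X‖ := by positivity
  choose Z hZ hVZ using hrun.aligned
  have hVal : ∀ i, IsLeadingBasis (hXhat i) hrd.le (Valigned i) := fun i => by
    rw [hVZ i]
    exact (hVloc i).mul_orthogonal (hZ i).1
  have hpsd : ∀ i, _ := fun i => (hZ i).posSemidef (hVloc i).1
  simp only [← hVZ] at hpsd
  have main : ∀ V : Matrix (Fin d) (Fin r) ℝ, IsLeadingBasis hX hrd.le V →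
      (V.transpose * Vloc k).transpose = V.transpose * Vloc k →
      (∀ x, 0 ≤ x ⬝ᵥ (V.transpose * Vloc k).mulVec x) →
      ‖matrixAverage Valigned - V‖ ≤
        14 * (1 / δ ^ 2 * s) + 1 / δ * ‖matrixAverage Xhat - X‖ := by
    intro V hV hsymm hpos
    rw [← hε2]
    exact norm_matrixAverage_sub_le hr hrd _ hδ hgap hEε hε8 hV k (hVloc k) hVal hsymm hpos
      (fun i => (hpsd i).1) (fun i => (hpsd i).2)
  constructor
  · intro hal
    have h := hal.posSemidef (hVloc k).1
    rw [Matrix.mul_one] at h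
    linarith [main V₁ hV₁ h.1 h.2]
  · obtain ⟨U, hU, hsymm, hpos⟩ := exists_orthogonal_mul_posSemidef ((Vloc k).transpose * V₁)
    have hUU : U * U.transpose = 1 := (Matrix.mem_orthogonalGroup_iff _ _).mp hU
    have hV := hV₁.mul_orthogonal hU
    -- `V₁ U` is the rotation of `V₁` that is aligned with the reference solution.
    have hflip : (V₁ * U).transpose * Vloc k = (Vloc k).transpose * V₁ * U := by
      rw [← hsymm, Matrix.mul_assoc, Matrix.transpose_mul (Vloc k).transpose,
        Matrix.transpose_transpose]
    have hbound := main (V₁ * U) hV (by rw [hflip, hsymm]) (by rw [hflip]; exact hpos)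
    obtain ⟨R, hQ, -, hQR⟩ := hrun.output
    rw [hQR] at hbound
    have hdist := dist₂_le_of_norm_sub_le hQ hV.1 hbound
    have hproj : dist₂ Vout (V₁ * U) = dist₂ Vout V₁ := by
      rw [dist₂, dist₂, Matrix.transpose_mul, Matrix.mul_assoc V₁, ← Matrix.mul_assoc U, hUU,
        Matrix.one_mul]
    rw [hproj] at hdist
    linarith
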